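/- A \emph{signed graph} $\Sigma$ is a finite graph (loops and parallel edges allowed) whose edges $e$ carry signs $\operatorname{sgn}(e)\in\{+1,-1\}$. A \emph{coloring} $\kappa:V(\Sigma)\to\mathbb Z$ is \emph{proper} if $\kappa(u)\neq\operatorname{sgn}(e)\,\kappa(v)$ for every edge $e$ with endpoints $u,v$. An \emph{orientation} of $\Sigma$ assigns to every half-edge an arrow pointing toward or away from its vertex, such that on a positive edge exactly one of the two arrows points toward its vertex, and on a negative edge both or neither do. A \emph{cycle} of an orientation is a closed walk with at least one edge such that every vertex of the walk has at least one arrow pointing into it and at least one arrow pointing out of it among the arrows on the edges of the walk; an orientation is \emph{acyclic} if it has no cycle. A \emph{sink} is a vertex with no arrow pointing away from it, and $\operatorname{sink}(P)$ is the number of sinks of an orientation $P$. A proper coloring $\kappa$ \emph{preserves} the orientation $P$ if, for every edge $e$ with endpoints $u,v$, the arrow of $e$ at $v$ points toward $v$ if and only if $\operatorname{sgn}(e)\,\kappa(u)<\kappa(v)$ (for a loop this is required of each of its two half-edges, with $u=v$). A \emph{signed poset} is an acyclic orientation of some signed graph. Put $x^\kappa=\prod_{v}x_{\kappa(v)}$,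 in variables $x_i$ indexed by $i\in\mathbb Z$, and define the formal power series $X_\Sigma=\sum_{\kappa}x^{\kappa}$ over all proper colorings $\kappa$ of $\Sigma$, and, for a signed poset $P$ on $\Sigma$, $Y_P=\sum_\kappa x^\kappa$ over all proper colorings $\kappa$ of $\Sigma$ that preserve $P$. Let $\mathbb Y$ be the $\mathbb Q$-linear span of the series $Y_P$ for all signed posets $P$. \textbf{Theorem.} There is a unique $\mathbb Q$-linear map $\varphi:\mathbb Y\to\mathbb Q[t]$ such that $\varphi(Y_P)=t^{\operatorname{sink}(P)}$ for every signed poset $P$. For every signed graph $\Sigma$ one has $X_\Sigma=\sum_{P}Y_P$, the sum over all acyclic orientations $P$ of $\Sigma$; in particular $X_\Sigma\in\mathbb Y$. Moreover $$\varphi(X_\Sigma)=\sum_{k=0}^{\infty}\operatorname{acyc}_\Sigma(k)\,t^k,$$ where $\operatorname{acyc}_\Sigma(k)$ is the number of acyclic orientations of $\Sigma$ with exactly $k$ sinks (which is $0$ for $k>|V(\Sigma)|$). -/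

import Mathlib

universe u v

/-- A signed graph with vertices `V` and edges `E`; loops and parallel edges are allowed.
Each edge `e` has two half-edges `(e, false)` and `(e, true)`, attached to the vertices
`ends e false` and `ends e true` (equal for a loop), and a sign `sgn e`, which is `1` or `-1`. -/
structure SignedGraph (V : Type u) (E : Type v) where
  ends : E → Bool → V
  sgn : E → ℤˣ

/-- The generating series `∑_{κ ∈ C} ∏_v x_{κ v}` of a set `C` of colorings `κ : V → ℤ`, as a
formal power series in variables indexed by `ℤ`: the coefficient of a monomial is the number of
colorings in `C` with that monomial (a finite number, see `finite_colorings_with_monomial`). -/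
noncomputable def colorSeries {V : Type u} [Fintype V] (C : Set (V → ℤ)) : MvPowerSeries ℤ ℚ :=
  fun m => (Set.ncard {κ ∈ C | ∑ v, Finsupp.single (κ v) 1 = m} : ℚ)

theorem finite_colorings_with_monomial {V : Type u} [Fintype V] (C : Set (V → ℤ)) (m : ℤ →₀ ℕ) :
    {κ ∈ C | ∑ v, Finsupp.single (κ v) 1 = m}.Finite := by
  refine (Set.Finite.pi' (fun _ : V => m.support.finite_toSet)).subset ?_
  rintro κ ⟨-, rfl⟩ v
  have h : (1 : ℕ) ≤ ∑ w, (Finsupp.single (κ w) 1 : ℤ →₀ ℕ) (κ v) := by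
    refine le_trans ?_ (Finset.single_le_sum
      (f := fun w => (Finsupp.single (κ w) 1 : ℤ →₀ ℕ) (κ v)) (fun _ _ => Nat.zero_le _)
      (Finset.mem_univ v))
    simp
  simp only [Finset.mem_coe, Finsupp.mem_support_iff, Finsupp.finsetSum_apply]
  omega

namespace SignedGraph

variable {V : Type u} {E : Type v}

/-- Proper colorings: `κ u ≠ sgn e * κ v` for every edge `e` with endpoints `u`, `v`. -/
def IsProper (G : SignedGraph V E) (κ : V → ℤ) : Prop :=
  ∀ e, κ (G.ends e false) ≠ (G.sgn e : ℤ) * κ (G.ends e true)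

/-- The chromatic `B`-symmetric function `X_Σ`. -/
noncomputable def chromaticB [Fintype V] (G : SignedGraph V E) : MvPowerSeries ℤ ℚ :=
  colorSeries {κ | G.IsProper κ}

/-- An orientation puts an arrow on every half-edge, pointing toward its vertex (`inward = true`) or
away from it (`inward = false`). On a positive edge the two arrows run in the same direction along
the edge (one is inward, the other is not); on a negative edge they run in opposite directions
(both are inward or both are outward). -/
structure Orientation (G : SignedGraph V E) where
  inward : E → Bool → Bool
  compat : ∀ e, inward e false = inward e true ↔ G.sgn e = -1

namespace Orientation

variable {G : SignedGraph V E}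

instance [Finite E] : Finite G.Orientation :=
  Finite.of_injective (fun P : G.Orientation => P.inward)
    (by rintro ⟨_, _⟩ ⟨_, _⟩ h; cases h; rfl)

/-- There is an arrow pointing into `v` (if `b = true`), or out of `v` (if `b = false`), on one of
the edges in the set `S`. -/
def HasArrow (P : G.Orientation) (S : Set E) (v : V) (b : Bool) : Prop :=
  ∃ e ∈ S, ∃ i, G.ends e i = v ∧ P.inward e i = b

/-- `w` is a closed walk with at least one step: the step `w j = (e, i)` traverses the edge `e` from
`ends e i` to `ends e (!i)`, and (indices being cyclic) the next step starts where it ends.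
It is a cycle of the orientation `P` if every vertex on it has an arrow pointing into it and an
arrow pointing out of it, when only the edges in the walk are considered. -/
def IsCycle (P : G.Orientation) {m : ℕ} (w : Fin (m + 1) → E × Bool) : Prop :=
  (∀ j, G.ends (w j).1 (!(w j).2) = G.ends (w (j + 1)).1 (w (j + 1)).2) ∧
    ∀ j b, P.HasArrow (Set.range fun l => (w l).1) (G.ends (w j).1 (w j).2) b

/-- An orientation is acyclic if it has no cycle. -/
def IsAcyclic (P : G.Orientation) : Prop :=
  ∀ (m : ℕ) (w : Fin (m + 1) → E × Bool), ¬ P.IsCycle w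

/-- A sink is a vertex all of whose arrows point toward it (isolated vertices are sinks). -/
def IsSink (P : G.Orientation) (v : V) : Prop :=
  ∀ e i, G.ends e i = v → P.inward e i = true

/-- The number of sinks of `P`. -/
noncomputable def sinkCount (P : G.Orientation) : ℕ :=
  Set.ncard {v | P.IsSink v}

/-- The coloring `κ` preserves (induces) the orientation `P`. In the covering graph, `+v` is joined
to `sgn e • u` for each edge `e` with endpoints `v`, `u`, these two vertices have the colors `κ v`
and `sgn e * κ u`, and lower colors point to higher colors. So the arrow of `e` at `v` points
toward `v` exactly if `sgn e * κ u < κ v`. -/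
def IsPreservedBy (P : G.Orientation) (κ : V → ℤ) : Prop :=
  ∀ e i, P.inward e i = true ↔ (G.sgn e : ℤ) * κ (G.ends e (!i)) < κ (G.ends e i)

/-- The series `Y_P`, the sum of `x^κ` over the proper colorings `κ` that preserve `P`. -/
noncomputable def ySeries [Fintype V] (P : G.Orientation) : MvPowerSeries ℤ ℚ :=
  colorSeries {κ | G.IsProper κ ∧ P.IsPreservedBy κ}

end Orientation

open Classical in
/-- The set of acyclic orientations of a signed graph. -/
noncomputable def acyclicOrientations [Finite E] (G : SignedGraph V E) : Finset G.Orientation :=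
  letI := Fintype.ofFinite G.Orientation
  Finset.univ.filter fun P => P.IsAcyclic

/-- The number of acyclic orientations with exactly `k` sinks. -/
noncomputable def acyc [Finite E] (G : SignedGraph V E) (k : ℕ) : ℕ :=
  (G.acyclicOrientations.filter fun P => P.sinkCount = k).card

end SignedGraph

/-- The `ℚ`-span of the series `Y_P`, where `P` ranges over all signed posets, that is, over all
acyclic orientations of finite signed graphs. -/
noncomputable def signedPosetSpan : Submodule ℚ (MvPowerSeries ℤ ℚ) :=
  Submodule.span ℚ {Y | ∃ (V : Type u) (E : Type v) (_ : Fintype V) (_ : Finite E)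
    (G : SignedGraph V E) (P : G.Orientation), P.IsAcyclic ∧ Y = P.ySeries}

theorem ySeries_mem_span {V : Type u} {E : Type v} [Fintype V] [Finite E] {G : SignedGraph V E}
    (P : G.Orientation) (hP : P.IsAcyclic) : P.ySeries ∈ signedPosetSpan.{u, v} :=
  Submodule.subset_span ⟨V, E, inferInstance, inferInstance, G, P, hP, rfl⟩

/-- The linear map `φ` takes the value `t ^ sink(P)` at `Y_P`, for every signed poset `P`. -/
def IsSinkCounting (φ : signedPosetSpan.{u, v} →ₗ[ℚ] Polynomial ℚ) : Prop :=
  ∀ (V : Type u) (E : Type v) [Fintype V] [Finite E] (G : SignedGraph V E) (P : G.Orientation)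
    (hP : P.IsAcyclic), φ ⟨P.ySeries, ySeries_mem_span P hP⟩ = Polynomial.X ^ P.sinkCount

/-!
The equation `X_Σ = ∑_P Y_P` holds because a proper coloring determines the arrow on every half-edge
by the strict inequalities between colors, and the resulting orientation has no cycle: on a closed
walk, a vertex whose color has the largest absolute value has arrows in one direction only
(`chromaticB_eq_sum`). Uniqueness of `φ` is clear, and the formula for `φ (X_Σ)` follows by
linearity. What remains is the existence of `φ`: the number of sinks of `P` has to be read off
linearly from the coefficients of `Y_P`.

Let `d` be the number of vertices of `P`, and write `t ^ sink(P) = ∑_T (t - 1) ^ #T` over the sets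
`T` of sinks. For `N ≥ 1`, a coloring preserving `P` with colors in `(-N, N]` takes the color `N` on
a set `T` of sinks, and every set of sinks occurs: the preserving colorings with
`κ ⁻¹' {N} = T` correspond to the strict colorings with colors in `(-N, N)` of the restriction of
`P` to the complement of `T` (`card_filter_shell_eq`). The number `a_W(N)` of such colorings of the
restriction to `W` is a polynomial in `N ≥ 1` of degree at most `#W`, whose value at `N = 0` is
`(-1) ^ #W`, whatever the acyclic orientation is. So extrapolating to `N = 0` the sum of the
coefficients of those monomials which contain `x_N` exactly `j` times, and otherwise only variables
`x_i` with `|i| < N`, yields `(-1) ^ (d - j)` times the number of sets `T` of `j` sinks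
(`sinkFunctional_ySeries`).

Polynomiality and the value at `0` are proved together. Put `a_W(0) = (-1) ^ #W`. Splitting off
the vertices where `κ = ± N` gives `a_W(N + 1) = ∑ a_{W \ (A ∪ B)}(N)` over the disjoint sets `A`
of sinks and `B` of sources of the restriction to `W` (`orderCount_succ`). For `N = 0`, the right
hand side is a product over the vertices in which a sink or source that is not isolated contributes
the factor `0`, and acyclicity provides such a vertex if there is an edge
(`IsAcyclic.exists_not_hasArrow`). By induction on `#W`, the recursion makes the iterated
differences of `a_W` vanish (`fwdDiff_iter_orderCount`).
-/

namespace SignedGraph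

variable {V : Type u} {E : Type v} {G : SignedGraph V E}

/-! ### Acyclic orientations have sinks or sources -/

/-- `G.IsWalk S u l w` says that the list of steps `l` is a walk from `u` to `w` along edges in `S`;
as in `Orientation.IsCycle`, the step `(e, i)` goes from `G.ends e i` to `G.ends e (!i)`. -/
def IsWalk (G : SignedGraph V E) (S : Set E) : V → List (E × Bool) → V → Prop
  | u, [], w => u = w
  | u, a :: l, w => a.1 ∈ S ∧ G.ends a.1 a.2 = u ∧ G.IsWalk S (G.ends a.1 (!a.2)) l w

theorem IsWalk.append {S : Set E} {l l' : List (E × Bool)} {u w x : V} (h : G.IsWalk S u l w)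
    (h' : G.IsWalk S w l' x) : G.IsWalk S u (l ++ l') x := by
  induction l generalizing u with
  | nil => cases h; exact h'
  | cons a l ih => exact ⟨h.1, h.2.1, ih h.2.2⟩

theorem IsWalk.exists_reverse {S : Set E} {l : List (E × Bool)} {u w : V}
    (h : G.IsWalk S u l w) : ∃ l', G.IsWalk S w l' u := by
  induction l generalizing u with
  | nil => exact ⟨[], h.symm⟩
  | cons a l ih =>
    obtain ⟨l', hl'⟩ := ih h.2.2
    refine ⟨l' ++ [(a.1, !a.2)], hl'.append ⟨h.1, rfl, ?_⟩⟩
    simpa [IsWalk] using h.2.1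

theorem IsWalk.exists_of_mem {S : Set E} {l : List (E × Bool)} {u w : V} (h : G.IsWalk S u l w)
    {a : E × Bool} (ha : a ∈ l) : a.1 ∈ S ∧ ∃ l', G.IsWalk S u l' (G.ends a.1 a.2) := by
  induction l generalizing u with
  | nil => simp at ha
  | cons b l ih =>
    rcases List.mem_cons.1 ha with rfl | ha
    · exact ⟨h.1, [], h.2.1.symm⟩
    · obtain ⟨h1, l', h2⟩ := ih h.2.2 ha
      exact ⟨h1, b :: l', h.1, h.2.1, h2⟩

theorem IsWalk.ends_castSucc {S : Set E} {a : E × Bool} {l : List (E × Bool)} {u w : V}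
    (h : G.IsWalk S u (a :: l) w) (j : Fin l.length) :
    G.ends ((a :: l).get j.castSucc).1 (!((a :: l).get j.castSucc).2) =
      G.ends ((a :: l).get j.succ).1 ((a :: l).get j.succ).2 := by
  induction l generalizing u a with
  | nil => exact j.elim0
  | cons b l ih =>
    refine Fin.cases ?_ (fun j => ?_) j
    · exact h.2.2.2.1.symm
    · exact ih h.2.2 j

theorem IsWalk.ends_last {S : Set E} {a : E × Bool} {l : List (E × Bool)} {u w : V}
    (h : G.IsWalk S u (a :: l) w) :
    G.ends ((a :: l).get (Fin.last l.length)).1 (!((a :: l).get (Fin.last l.length)).2) = w := by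
  induction l generalizing u a with
  | nil => exact h.2.2
  | cons b l ih => exact ih h.2.2

/-- Excursions from `u` can be concatenated, so that any finite set of edges in `S` which can be
reached from `u` inside `S` lies on one closed walk. -/
theorem exists_closed_walk_through {S : Set E} {u : V} (T : Finset E) (hTS : ∀ e ∈ T, e ∈ S)
    (hT : ∀ e ∈ T, ∃ i l, G.IsWalk S u l (G.ends e i)) :
    ∃ l, G.IsWalk S u l u ∧ ∀ e ∈ T, ∃ i, (e, i) ∈ l := by
  classical
  induction T using Finset.induction_on with
  | empty => exact ⟨[], rfl, by simp⟩
  | insert e T he ih =>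
    obtain ⟨l, hl, hlT⟩ := ih (fun e h => hTS e (Finset.mem_insert_of_mem h))
      fun e h => hT e (Finset.mem_insert_of_mem h)
    obtain ⟨i, p, hp⟩ := hT e (Finset.mem_insert_self e T)
    have heS := hTS e (Finset.mem_insert_self e T)
    have hp' : G.IsWalk S u (p ++ [(e, i)]) (G.ends e (!i)) := hp.append ⟨heS, rfl, rfl⟩
    obtain ⟨q, hq⟩ := hp'.exists_reverse
    refine ⟨(p ++ [(e, i)]) ++ q ++ l, (hp'.append hq).append hl, fun e' he' => ?_⟩
    rcases Finset.mem_insert.1 he' with rfl | he'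
    · exact ⟨i, by simp⟩
    · obtain ⟨i', h⟩ := hlT e' he'
      exact ⟨i', by simp [h]⟩

namespace Orientation

/-- In an acyclic orientation, every nonempty set `S` of edges has an endpoint at which the arrows
on `S` all point in or all point out: otherwise a closed walk through all edges of a connected
component of `S` would be a cycle. -/
theorem IsAcyclic.exists_not_hasArrow [Finite E] {P : G.Orientation} (hP : P.IsAcyclic) {S : Set E}
    (hS : S.Nonempty) : ∃ e ∈ S, ∃ i b, ¬ P.HasArrow S (G.ends e i) b := by
  classical
  by_contra! hall
  obtain ⟨e₀, he₀⟩ := hS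
  set u := G.ends e₀ false with hu
  -- the edges of the component of `u`
  let T : Finset E := (Set.toFinite {e ∈ S | ∃ i l, G.IsWalk S u l (G.ends e i)}).toFinset
  have hT : ∀ e, e ∈ T ↔ e ∈ S ∧ ∃ i l, G.IsWalk S u l (G.ends e i) := fun e => by
    simp only [T, Set.Finite.mem_toFinset, Set.mem_ofPred_eq]
  obtain ⟨l, hl, hlT⟩ := exists_closed_walk_through T (fun e h => ((hT e).1 h).1)
    fun e h => ((hT e).1 h).2
  have hne : ∃ i, (e₀, i) ∈ l := hlT e₀ ((hT e₀).2 ⟨he₀, false, [], rfl⟩)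
  rcases l with _ | ⟨a, l⟩
  · simp at hne
  refine hP l.length (fun j => (a :: l).get j) ⟨fun j => ?_, fun j b => ?_⟩
  · induction j using Fin.lastCases with
    | last =>
      rw [Fin.last_add_one]
      exact hl.ends_last.trans hl.2.1.symm
    | cast j =>
      rw [Fin.coeSucc_eq_succ]
      exact hl.ends_castSucc j
  · obtain ⟨hjS, p, hp⟩ := hl.exists_of_mem (List.get_mem (a :: l) j)
    obtain ⟨e, heS, i, hei, hb⟩ := hall _ hjS ((a :: l).get j).2 b
    obtain ⟨i', hi'⟩ := hlT e ((hT e).2 ⟨heS, i, p, hei ▸ hp⟩)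
    obtain ⟨k, hk⟩ := List.get_of_mem hi'
    exact ⟨e, ⟨k, by simp only [hk]⟩, i, hei, hb⟩

/-! ### Proper colorings and orientations -/

/-- The coloring `κ` strictly respects both arrows of the edge `e`. -/
def Compatible (P : G.Orientation) (κ : V → ℤ) (e : E) : Prop :=
  ∀ i, (P.inward e i = true → (G.sgn e : ℤ) * κ (G.ends e (!i)) < κ (G.ends e i)) ∧
    (P.inward e i = false → κ (G.ends e i) < (G.sgn e : ℤ) * κ (G.ends e (!i)))

theorem isProper_and_isPreservedBy_iff (P : G.Orientation) (κ : V → ℤ) :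
    G.IsProper κ ∧ P.IsPreservedBy κ ↔ ∀ e, P.Compatible κ e := by
  constructor
  · rintro ⟨h1, h2⟩ e i
    have h1 := h1 e
    have h2 := h2 e i
    have h3 : κ (G.ends e i) ≠ (G.sgn e : ℤ) * κ (G.ends e (!i)) := by
      rcases Int.units_eq_one_or (G.sgn e) with hs | hs <;> cases i <;> simp [hs] at h1 ⊢ <;> omega
    refine ⟨fun h => h2.1 h, fun h => ?_⟩
    rw [h] at h2
    simp only [Bool.false_eq_true, false_iff, not_lt] at h2
    exact lt_of_le_of_ne h2 h3
  · intro h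
    refine ⟨fun e => ?_, fun e i => ⟨(h e i).1, fun h' => ?_⟩⟩
    · cases hi : P.inward e false
      · exact ((h e false).2 hi).ne
      · exact ((h e false).1 hi).ne'
    · by_contra hi
      exact (((h e i).2 (by simpa using hi)).trans h').false

theorem eq_of_isPreservedBy {P Q : G.Orientation} {κ : V → ℤ} (hP : P.IsPreservedBy κ)
    (hQ : Q.IsPreservedBy κ) : P = Q := by
  have h : P.inward = Q.inward := by
    funext e i
    rw [Bool.eq_iff_iff, hP e i, hQ e i]
  cases P; cases Q; cases h; rfl

/-- A vertex with color of largest absolute value among those on a closed walk has arrows in only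
one direction there. -/
theorem isAcyclic_of_compatible {P : G.Orientation} {κ : V → ℤ} (h : ∀ e, P.Compatible κ e) :
    P.IsAcyclic := by
  rintro m w ⟨hw, hc⟩
  obtain ⟨j, hj⟩ := Finite.exists_max fun j => |κ (G.ends (w j).1 (w j).2)|
  have hmax : ∀ l i, |κ (G.ends (w l).1 i)| ≤ |κ (G.ends (w j).1 (w j).2)| := by
    intro l i
    rcases eq_or_ne i (w l).2 with rfl | hi
    · exact hj l
    · rw [Bool.eq_not.2 hi, hw l]
      exact hj (l + 1)
  obtain ⟨e, ⟨l, rfl⟩, i, hei, hb⟩ := hc j (decide (κ (G.ends (w j).1 (w j).2) ≤ 0))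
  have h1 := h (w l).1 i
  have h2 := hmax l (!i)
  rw [hei, hb] at h1
  generalize κ (G.ends (w j).1 (w j).2) = x at *
  generalize κ (G.ends (w l).1 (!i)) = y at *
  have h3 : |(G.sgn (w l).1 : ℤ) * y| ≤ |x| := by
    rcases Int.units_eq_one_or (G.sgn (w l).1) with hs | hs <;> simpa [hs] using h2
  by_cases hx : x ≤ 0
  · have := h1.1 (by simpa using hx)
    rw [abs_of_nonpos hx] at h3
    have := (abs_le.1 h3).1
    omega
  · have := h1.2 (by simpa using hx)
    rw [abs_of_pos (not_le.1 hx)] at h3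
    have := le_of_abs_le h3
    omega

end Orientation

theorem IsProper.exists_orientation {κ : V → ℤ} (h : G.IsProper κ) :
    ∃ P : G.Orientation, P.IsPreservedBy κ := by
  refine ⟨⟨fun e i => decide ((G.sgn e : ℤ) * κ (G.ends e (!i)) < κ (G.ends e i)), fun e => ?_⟩,
    fun e i => by simp⟩
  have h := h e
  rcases Int.units_eq_one_or (G.sgn e) with hs | hs <;> rw [Bool.eq_iff_iff] <;>
    simp [hs] at h ⊢ <;> omega

/-- Every proper coloring preserves exactly one orientation, and this orientation is acyclic. -/
theorem chromaticB_eq_sum [Fintype V] [Finite E] (G : SignedGraph V E) :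
    G.chromaticB = ∑ P ∈ G.acyclicOrientations, P.ySeries := by
  classical
  funext m
  let F (P : G.Orientation) : Finset (V → ℤ) := (finite_colorings_with_monomial
    {κ | G.IsProper κ ∧ P.IsPreservedBy κ} m).toFinset
  have hF (P : G.Orientation) : P.ySeries m = ((F P).card : ℚ) := by
    simp only [Orientation.ySeries, colorSeries, F]
    rw [Set.ncard_eq_toFinset_card _ (finite_colorings_with_monomial _ m)]
  have hsum : (∑ P ∈ G.acyclicOrientations, P.ySeries) m =
      ∑ P ∈ G.acyclicOrientations, P.ySeries m :=
    Finset.sum_apply m G.acyclicOrientations fun P => (P.ySeries : (ℤ →₀ ℕ) → ℚ)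
  rw [hsum, Finset.sum_congr rfl fun P _ => hF P, ← Nat.cast_sum, ← Finset.card_biUnion]
  · rw [chromaticB, colorSeries, Nat.cast_inj, ← Set.ncard_coe_finset]
    congr 1
    ext κ
    simp only [Finset.coe_biUnion, Set.mem_iUnion, Set.mem_ofPred_eq, Finset.mem_coe, F,
      Set.Finite.mem_toFinset, acyclicOrientations, Finset.mem_filter, exists_prop]
    constructor
    · rintro ⟨h, hm⟩
      obtain ⟨P, hP⟩ := h.exists_orientation
      exact ⟨P, ⟨by simp, Orientation.isAcyclic_of_compatible
        ((P.isProper_and_isPreservedBy_iff κ).1 ⟨h, hP⟩)⟩, ⟨h, hP⟩, hm⟩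
    · rintro ⟨P, -, ⟨h, -⟩, hm⟩
      exact ⟨h, hm⟩
  · intro P _ Q _ hPQ
    refine Finset.disjoint_left.2 fun κ hP hQ => hPQ ?_
    simp only [F, Set.Finite.mem_toFinset] at hP hQ
    exact Orientation.eq_of_isPreservedBy hP.1.2 hQ.1.2

end SignedGraph

namespace SignedGraph
namespace Orientation

variable {V : Type u} {E : Type v} {G : SignedGraph V E}

/-! ### Counting strict colorings with bounded colors -/

/-- The vertex `v` lies in `W`, and all arrows at `v` on edges inside `W` point in (`b = true`,
so that `v` is a sink of the restriction to `W`) or out (`b = false`, so that `v` is a source). -/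
def IsExtremal (P : G.Orientation) (W : Finset V) (v : V) (b : Bool) : Prop :=
  v ∈ W ∧ ∀ e, (∀ i, G.ends e i ∈ W) → ∀ i, G.ends e i = v → P.inward e i = b

open Classical in
/-- The colors, relative to the largest absolute value in use, that a strict coloring of the
restriction to `W` may take at `v`: the largest color `1` is possible at sinks only and the
smallest color `-1` at sources only, while `0` stands for all other colors. -/
noncomputable def shellSigns (P : G.Orientation) (W : Finset V) (v : V) : Finset SignType :=
  Finset.univ.filter fun s =>
    (s = 1 → P.IsExtremal W v true) ∧ (s = -1 → P.IsExtremal W v false)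

theorem mem_shellSigns {P : G.Orientation} {W : Finset V} {v : V} {s : SignType} :
    s ∈ P.shellSigns W v ↔
      (s = 1 → P.IsExtremal W v true) ∧ (s = -1 → P.IsExtremal W v false) := by
  simp [shellSigns]

/-- Where the coloring `κ` takes the values `N` and `-N`. -/
def shell (N : ℕ) (κ : V → ℤ) (v : V) : SignType :=
  if κ v = N then 1 else if κ v = -N then -1 else 0

theorem mem_of_shell_ne_zero {P : G.Orientation} {W : Finset V} {v : V} {s : SignType}
    (h : s ∈ P.shellSigns W v) (hs : s ≠ 0) : v ∈ W := by
  rw [mem_shellSigns] at h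
  cases s with
  | zero => exact absurd rfl hs
  | pos => exact (h.1 rfl).1
  | neg => exact (h.2 rfl).1

/-- Coloring the vertices with sign `1` or `-1` by `N` or `-N` creates no conflict with the
smaller colors of the other vertices. -/
theorem compatible_of_shellSigns {P : G.Orientation} {W : Finset V} {N : ℕ}
    {s : V → SignType} (hs : ∀ v, s v ∈ P.shellSigns W v) {κ κ' : V → ℤ}
    (hκ : ∀ v, -(N : ℤ) < κ v ∧ κ v < N)
    (hκ' : ∀ v, κ' v = if s v = 0 then κ v else N * (s v : ℤ)) {e : E}
    (he : ∀ i, G.ends e i ∈ W) (h3 : (∀ i, s (G.ends e i) = 0) → P.Compatible κ e) :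
    P.Compatible κ' e := by
  intro i
  have hmem : ∀ v, (κ' v = N ∧ P.IsExtremal W v true) ∨ (κ' v = -N ∧ P.IsExtremal W v false) ∨
      (κ' v = κ v ∧ s v = 0) := by
    intro v
    have := mem_shellSigns.1 (hs v)
    rw [hκ' v]
    rcases hsv : s v
    · simp
    · right; left; exact ⟨by simp, this.2 hsv⟩
    · left; exact ⟨by simp, this.1 hsv⟩
  have hx := hmem (G.ends e i)
  have hy := hmem (G.ends e (!i))
  have hxκ := hκ (G.ends e i)
  have hyκ := hκ (G.ends e (!i))
  have hi : P.inward e i = P.inward e (!i) ↔ G.sgn e = -1 := by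
    cases i
    · exact P.compat e
    · exact eq_comm.trans (P.compat e)
  have h4 : s (G.ends e i) = 0 → s (G.ends e (!i)) = 0 → _ := fun h h' => h3 (by
    intro j
    rcases eq_or_ne j i with rfl | hj
    · exact h
    · rwa [Bool.eq_not.2 hj]) i
  have hxb : ∀ b, P.IsExtremal W (G.ends e i) b → P.inward e i = b := fun b h => h.2 e he i rfl
  have hyb : ∀ b, P.IsExtremal W (G.ends e (!i)) b → P.inward e (!i) = b :=
    fun b h => h.2 e he _ rfl
  generalize P.inward e i = a at *
  generalize P.inward e (!i) = b at *
  generalize κ' (G.ends e i) = x' at *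
  generalize κ' (G.ends e (!i)) = y' at *
  generalize κ (G.ends e i) = x at *
  generalize κ (G.ends e (!i)) = y at *
  have hN' : 0 < (N : ℤ) := by omega
  generalize (N : ℤ) = n at *
  have hsg := Int.units_eq_one_or (G.sgn e)
  generalize G.sgn e = g at *
  rcases hx with ⟨rfl, hx⟩ | ⟨rfl, hx⟩ | ⟨rfl, hx⟩
  · obtain rfl := hxb _ hx
    rcases hy with ⟨rfl, hy⟩ | ⟨rfl, hy⟩ | ⟨rfl, hy⟩
    · obtain rfl := hyb _ hy
      rcases hsg with rfl | rfl <;> simp at hi ⊢; omega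
    · obtain rfl := hyb _ hy
      rcases hsg with rfl | rfl <;> simp at hi ⊢; omega
    · rcases hsg with rfl | rfl <;> simp <;> omega
  · obtain rfl := hxb _ hx
    rcases hy with ⟨rfl, hy⟩ | ⟨rfl, hy⟩ | ⟨rfl, hy⟩
    · obtain rfl := hyb _ hy
      rcases hsg with rfl | rfl <;> simp at hi ⊢; omega
    · obtain rfl := hyb _ hy
      rcases hsg with rfl | rfl <;> simp at hi ⊢; omega
    · rcases hsg with rfl | rfl <;> simp <;> omega
  · rcases hy with ⟨rfl, hy⟩ | ⟨rfl, hy⟩ | ⟨rfl, hy⟩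
    · obtain rfl := hyb _ hy
      rcases hsg with rfl | rfl <;> cases a <;> simp at hi ⊢ <;> omega
    · obtain rfl := hyb _ hy
      rcases hsg with rfl | rfl <;> cases a <;> simp at hi ⊢ <;> omega
    · exact h4 hx hy

variable [Fintype V]

open Classical in
/-- The strict colorings of the restriction of `P` to `W` with colors in the open interval
`(-N, N)`, extended by `0` outside `W`. -/
noncomputable def strictColorings (P : G.Orientation) (W : Finset V) (N : ℕ) : Finset (V → ℤ) :=
  (Fintype.piFinset fun v => if v ∈ W then Finset.Ioo (-N : ℤ) N else {0}).filter fun κ =>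
    ∀ e, (∀ i, G.ends e i ∈ W) → P.Compatible κ e

theorem mem_strictColorings {P : G.Orientation} {W : Finset V} {N : ℕ} {κ : V → ℤ} :
    κ ∈ P.strictColorings W N ↔ (∀ v ∈ W, -(N : ℤ) < κ v ∧ κ v < N) ∧ (∀ v ∉ W, κ v = 0) ∧
      ∀ e, (∀ i, G.ends e i ∈ W) → P.Compatible κ e := by
  simp only [strictColorings, Finset.mem_filter, Fintype.mem_piFinset, ← and_assoc]
  refine and_congr_left fun _ => ⟨fun h => ⟨fun v hv => ?_, fun v hv => ?_⟩, fun h v => ?_⟩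
  · simpa [hv] using h v
  · simpa [hv] using h v
  · by_cases hv : v ∈ W
    · simpa [hv] using h.1 v hv
    · simpa [hv] using h.2 v hv

theorem shell_mem_shellSigns {P : G.Orientation} {W : Finset V} {N : ℕ} (hN : N ≠ 0) {κ : V → ℤ}
    (hκ : κ ∈ P.strictColorings W (N + 1)) (v : V) : shell N κ v ∈ P.shellSigns W v := by
  obtain ⟨h1, h2, h3⟩ := mem_strictColorings.1 hκ
  push_cast at h1
  have hbd : ∀ e i, (∀ i, G.ends e i ∈ W) →
      -(N : ℤ) ≤ (G.sgn e : ℤ) * κ (G.ends e i) ∧ (G.sgn e : ℤ) * κ (G.ends e i) ≤ N := by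
    intro e i he
    have := h1 _ (he i)
    rcases Int.units_eq_one_or (G.sgn e) with hs | hs <;> simp [hs] <;> omega
  rw [mem_shellSigns, shell]
  constructor
  · intro h
    have hv : κ v = N := by
      by_contra hv
      rw [if_neg hv] at h
      split_ifs at h
    refine ⟨by_contra fun hW => ?_, fun e he i hi => ?_⟩
    · have := h2 v hW
      omega
    · by_contra hb
      have h4 := (h3 e he i).2 (by simpa using hb)
      have h5 := (hbd e (!i) he).2
      rw [hi] at h4
      omega
  · intro h
    have hv : κ v = -N := by
      by_contra hv
      rw [if_neg hv] at h
      split_ifs at h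
    refine ⟨by_contra fun hW => ?_, fun e he i hi => ?_⟩
    · have := h2 v hW
      omega
    · by_contra hb
      have h4 := (h3 e he i).1 (by simpa using hb)
      have h5 := (hbd e (!i) he).1
      rw [hi] at h4
      omega

open Classical in
/-- The colorings with a prescribed outermost shell `s` correspond to the colorings of what is left
when the shell is removed: the edges meeting the shell impose no further condition. -/
theorem card_filter_shell_eq {P : G.Orientation} {W : Finset V} {N : ℕ} (hN : N ≠ 0)
    {s : V → SignType} (hs : ∀ v, s v ∈ P.shellSigns W v) :
    ((P.strictColorings W (N + 1)).filter fun κ => shell N κ = s).card =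
      (P.strictColorings (W.filter fun v => s v = 0) N).card := by
  have hsW : ∀ v, v ∉ W → s v = 0 := fun v hv =>
    by_contra fun h => hv (mem_of_shell_ne_zero (hs v) h)
  refine Finset.card_bij' (fun κ _ v => if s v = 0 then κ v else 0)
    (fun κ _ v => if s v = 0 then κ v else N * (s v : ℤ)) ?_ ?_ ?_ ?_
  · intro κ hκs
    obtain ⟨hκ, hs'⟩ := Finset.mem_filter.1 hκs
    have hs' := congrFun hs'
    obtain ⟨h1, h2, h3⟩ := mem_strictColorings.1 hκ
    refine mem_strictColorings.2 ⟨fun v hv => ?_, fun v hv => ?_, fun e he i => ?_⟩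
    · obtain ⟨hv, hv0⟩ := Finset.mem_filter.1 hv
      have := h1 v hv
      have hsv := hs' v
      rw [hv0, shell] at hsv
      rw [if_pos hv0]
      split_ifs at hsv
      omega
    · by_cases hvW : v ∈ W
      · rw [if_neg fun h => hv (Finset.mem_filter.2 ⟨hvW, h⟩)]
      · rw [h2 v hvW, ite_self]
    · simp only [Finset.mem_filter] at he
      simp only [(he _).2, if_true]
      exact h3 e (fun i => (he i).1) i
  · intro κ hκ
    obtain ⟨h1, h2, h3⟩ := mem_strictColorings.1 hκ
    have h1' : ∀ v, -(N : ℤ) < κ v ∧ κ v < N := by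
      intro v
      by_cases hv : v ∈ W.filter fun v => s v = 0
      · exact h1 v hv
      · rw [h2 v hv]; omega
    refine Finset.mem_filter.2 ⟨mem_strictColorings.2 ⟨fun v hv => ?_, fun v hv => ?_,
      fun e he i => ?_⟩, funext fun v => ?_⟩
    · have := h1' v
      rcases hsv : s v <;> simp <;> omega
    · rw [if_pos (hsW v hv)]
      exact h2 v (by simp [hv])
    · refine compatible_of_shellSigns hs h1' (fun v => rfl) he (fun h => h3 e fun i => ?_) i
      exact Finset.mem_filter.2 ⟨he i, h i⟩
    · have := h1' v
      simp only [shell]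
      obtain hsv | hsv | hsv : s v = 0 ∨ s v = -1 ∨ s v = 1 := by cases s v <;> decide
      · simp only [hsv, if_true]
        rw [if_neg (by omega), if_neg (by omega)]
      · simp [hsv]; omega
      · simp [hsv]
  · intro κ hκs
    obtain ⟨hκ, hs'⟩ := Finset.mem_filter.1 hκs
    have hs' := congrFun hs'
    funext v
    have hsv := hs' v
    rw [shell] at hsv
    split_ifs at hsv with h h' <;> simp [← hsv, h]
    exact h'.symm
  · intro κ hκ
    obtain ⟨h1, h2, h3⟩ := mem_strictColorings.1 hκ
    funext v
    by_cases hv : s v = 0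
    · simp [hv]
    · simp only [hv, if_false]
      exact (h2 v (by simp [hv])).symm

end Orientation
end SignedGraph

namespace SignedGraph
namespace Orientation

variable {V : Type u} {E : Type v} {G : SignedGraph V E}

/-! ### Polynomiality and reciprocity of the number of strict colorings -/

theorem sum_shellSigns (P : G.Orientation) (W : Finset V) (v : V) (f : SignType → ℚ)
    [Decidable (P.IsExtremal W v true)] [Decidable (P.IsExtremal W v false)] :
    ∑ x ∈ P.shellSigns W v, f x = f 0 + (if P.IsExtremal W v true then f 1 else 0) +
      (if P.IsExtremal W v false then f (-1) else 0) := by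
  classical
  have h : P.shellSigns W v = {0} ∪ ((if P.IsExtremal W v true then {1} else ∅) ∪
      if P.IsExtremal W v false then {-1} else ∅) := by
    ext x
    rw [mem_shellSigns]
    split_ifs <;> cases x <;> simp_all
  rw [h]
  split_ifs <;> simp [add_assoc, add_left_comm]

variable [Fintype V]

/-- The number of strict colorings of the restriction of `P` to `W` with colors in `(-N, N)`, as a
function of `N ≥ 1`, continued to `N = 0` by `(-1) ^ #W`. By `fwdDiff_iter_orderCount`, this
continuation agrees with the one by polynomials. -/
noncomputable def orderCount (P : G.Orientation) (W : Finset V) (N : ℕ) : ℚ :=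
  if N = 0 then (-1) ^ W.card else (P.strictColorings W N).card

theorem card_strictColorings_one_of_isEmpty {P : G.Orientation} {W : Finset V}
    (h : ¬ ∃ e, ∀ i, G.ends e i ∈ W) : (P.strictColorings W 1).card = 1 := by
  rw [Finset.card_eq_one]
  refine ⟨0, Finset.ext fun κ => ?_⟩
  rw [mem_strictColorings, Finset.mem_singleton]
  constructor
  · rintro ⟨h1, h2, -⟩
    funext v
    by_cases hv : v ∈ W
    · have := h1 v hv
      simp only [Pi.zero_apply]
      omega
    · exact h2 v hv
  · rintro rfl
    exact ⟨by simp, by simp, fun e he => absurd ⟨e, he⟩ h⟩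

theorem card_strictColorings_one_of_mem {P : G.Orientation} {W : Finset V} {e : E}
    (he : ∀ i, G.ends e i ∈ W) : (P.strictColorings W 1).card = 0 := by
  rw [Finset.card_eq_zero, Finset.eq_empty_iff_forall_notMem]
  intro κ hκ
  obtain ⟨h1, -, h3⟩ := mem_strictColorings.1 hκ
  have h0 : ∀ i, κ (G.ends e i) = 0 := fun i => by have := h1 _ (he i); omega
  have := h3 e he false
  rw [h0, h0] at this
  cases h : P.inward e false <;> simp [h] at this

/-- The recursion for `orderCount` at `N = 0`. As a sum of products over the vertices, the right
hand side factors. A vertex contributes `0` if it is a sink or a source but not both, and acyclicity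
provides such a vertex as soon as there is an edge. -/
theorem sum_neg_one_pow_shellSigns [Finite E] {P : G.Orientation} (hP : P.IsAcyclic)
    (W : Finset V) [DecidableEq V] :
    ∑ s ∈ Fintype.piFinset (P.shellSigns W), (-1 : ℚ) ^ (W.filter fun v => s v = 0).card =
      (P.strictColorings W 1).card := by
  classical
  have h1 : ∀ s : V → SignType, (-1 : ℚ) ^ (W.filter fun v => s v = 0).card =
      ∏ v, if v ∈ W ∧ s v = 0 then -1 else 1 := by
    intro s
    rw [← Finset.prod_filter, Finset.prod_const]
    congr 2
    ext v
    simp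
  simp_rw [h1]
  rw [← Finset.prod_univ_sum (P.shellSigns W) fun v x => if v ∈ W ∧ x = 0 then (-1 : ℚ) else 1]
  simp_rw [sum_shellSigns]
  by_cases hW : ∃ e, ∀ i, G.ends e i ∈ W
  · obtain ⟨e, he⟩ := hW
    rw [card_strictColorings_one_of_mem he, Nat.cast_zero]
    obtain ⟨e, he, i, b, hb⟩ := hP.exists_not_hasArrow (S := {e | ∀ i, G.ends e i ∈ W}) ⟨e, he⟩
    have hx : ∀ c, P.IsExtremal W (G.ends e i) c ↔ c = !b := by
      refine fun c => ⟨fun h => ?_, fun h => ⟨he i, fun e' he' i' hi' => ?_⟩⟩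
      · rw [Bool.eq_not]
        rintro rfl
        exact hb ⟨e, he, i, rfl, h.2 e he i rfl⟩
      · rw [h, Bool.eq_not]
        exact fun h' => hb ⟨e', he', i', hi', h'⟩
    refine Finset.prod_eq_zero (Finset.mem_univ (G.ends e i)) ?_
    cases b <;> simp [hx, he i]
  · rw [card_strictColorings_one_of_isEmpty hW, Nat.cast_one]
    refine Finset.prod_eq_one fun v _ => ?_
    have hx : ∀ c, P.IsExtremal W v c ↔ v ∈ W :=
      fun c => ⟨fun h => h.1, fun h => ⟨h, fun e he => absurd ⟨e, he⟩ hW⟩⟩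
    by_cases hv : v ∈ W <;> simp [hx, hv]

/-- Splitting off the outermost shell of the colorings. -/
theorem orderCount_succ [Finite E] {P : G.Orientation} (hP : P.IsAcyclic) (W : Finset V) (N : ℕ)
    [DecidableEq V] :
    P.orderCount W (N + 1) =
      ∑ s ∈ Fintype.piFinset (P.shellSigns W), P.orderCount (W.filter fun v => s v = 0) N := by
  rcases eq_or_ne N 0 with rfl | hN
  · simp only [orderCount, if_true, zero_add, one_ne_zero, if_false]
    exact (sum_neg_one_pow_shellSigns hP W).symm
  · simp only [orderCount, hN, if_false, Nat.add_eq_zero_iff, false_and]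
    rw [Finset.card_eq_sum_card_fiberwise (f := shell N) (t := Fintype.piFinset (P.shellSigns W)),
      Nat.cast_sum]
    · refine Finset.sum_congr rfl fun s hs => ?_
      rw [← card_filter_shell_eq hN (Fintype.mem_piFinset.1 hs)]
    · intro κ hκ
      exact Fintype.mem_piFinset.2 (shell_mem_shellSigns hN hκ)

/-- The function `orderCount P W` is a polynomial of degree at most `#W`. -/
theorem fwdDiff_iter_orderCount [Finite E] {P : G.Orientation} (hP : P.IsAcyclic) (W : Finset V)
    {n : ℕ} (hn : W.card < n) : (fwdDiff 1)^[n] (P.orderCount W) = 0 := by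
  classical
  induction n generalizing W with
  | zero => omega
  | succ n ih =>
    have h0 : (0 : V → SignType) ∈ Fintype.piFinset (P.shellSigns W) :=
      Fintype.mem_piFinset.2 fun v => mem_shellSigns.2 (by simp)
    have h : fwdDiff 1 (P.orderCount W) = ∑ s ∈ (Fintype.piFinset (P.shellSigns W)).erase 0,
        P.orderCount (W.filter fun v => s v = 0) := by
      funext N
      rw [fwdDiff, orderCount_succ hP, Finset.sum_apply, ← Finset.add_sum_erase _ _ h0]
      simp
    rw [Function.iterate_succ_apply, h, fwdDiff_iter_finsetSum]
    refine Finset.sum_eq_zero fun s hs => ih _ ?_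
    obtain ⟨hs0, hs⟩ := Finset.mem_erase.1 hs
    obtain ⟨v, hv⟩ := Function.ne_iff.1 hs0
    refine lt_of_lt_of_le (Finset.card_lt_card ?_) (Nat.lt_succ_iff.1 hn)
    exact Finset.filter_ssubset.2
      ⟨v, mem_of_shell_ne_zero (Fintype.mem_piFinset.1 hs v) hv, hv⟩

end Orientation

/-- The value at `0` of the polynomial of degree at most `r` which takes the values `f 1`, …,
`f (r + 1)` at `1`, …, `r + 1`. -/
def extrapolate (r : ℕ) (f : ℕ → ℚ) : ℚ :=
  ∑ k ∈ Finset.range (r + 1), (-1) ^ k * (r + 1).choose (k + 1) * f (k + 1)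

theorem extrapolate_eq {r : ℕ} {f : ℕ → ℚ} (h : (fwdDiff 1)^[r + 1] f = 0) :
    extrapolate r f = f 0 := by
  have h0 := congrFun h 0
  rw [fwdDiff_iter_eq_sum_shift, Finset.sum_range_succ'] at h0
  have h1 : ∀ k ∈ Finset.range (r + 1),
      ((-1 : ℤ) ^ (r + 1 - (k + 1)) * (r + 1).choose (k + 1)) • f (0 + (k + 1) • 1) =
        (-1) ^ r * ((-1) ^ k * (r + 1).choose (k + 1) * f (k + 1)) := by
    intro k hk
    have hk : k ≤ r := Nat.lt_succ_iff.1 (Finset.mem_range.1 hk)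
    obtain ⟨m, rfl⟩ := Nat.exists_eq_add_of_le hk
    have : ((-1 : ℚ) ^ k) * (-1) ^ k = 1 := by rw [← mul_pow]; simp
    rw [zsmul_eq_mul, Nat.add_sub_add_right]
    push_cast
    rw [show k + m - k = m by omega, pow_add]
    simp only [smul_eq_mul, mul_one, zero_add]
    linear_combination (-(-1) ^ m * ((k + m + 1).choose (k + 1) : ℚ) * f (k + 1)) * this
  rw [Finset.sum_congr rfl h1, ← Finset.mul_sum] at h0
  have h2 : (-1 : ℚ) ^ r * (extrapolate r f - f 0) = 0 := by
    rw [extrapolate]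
    simp [pow_succ] at h0
    linear_combination h0
  simpa [sub_eq_zero] using h2

end SignedGraph

namespace SignedGraph

/-! ### The sink-counting functional -/

open Classical in
theorem sum_single_apply {V : Type u} [Fintype V] (κ : V → ℤ) (a : ℤ) :
    (∑ v, Finsupp.single (κ v) 1 : ℤ →₀ ℕ) a = (Finset.univ.filter fun v => κ v = a).card := by
  rw [Finsupp.finsetSum_apply, Finset.card_filter]
  simp only [Finsupp.single_apply]

theorem degree_sum_single {V : Type u} [Fintype V] (κ : V → ℤ) :
    (∑ v, Finsupp.single (κ v) 1 : ℤ →₀ ℕ).degree = Fintype.card V := by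
  simp [map_sum]

/-- The sum of the coefficients of the monomials that are the product of `x_N ^ j` and a monomial of
degree `r` in the variables `x_i` with `-N < i < N`. -/
noncomputable def shellSum (j r N : ℕ) : MvPowerSeries ℤ ℚ →ₗ[ℚ] ℚ :=
  ∑ m ∈ Finset.finsuppAntidiag (Finset.Ioo (-N : ℤ) N) r,
    MvPowerSeries.coeff (m + Finsupp.single (N : ℤ) j)

/-- On series of colorings of `d` vertices, this functional takes the value `t ^ sink(P)` at `Y_P`,
written as the sum of `(t - 1) ^ #T` over the sets `T` of sinks. The sets `T` of size `j` are
obtained from the colorings with largest absolute value `N` taken on `T` only, with positive sign;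
the number of extensions to the other `d - j` vertices becomes `(-1) ^ (d - j)` at `N = 0`. -/
noncomputable def sinkFunctional (d : ℕ) : MvPowerSeries ℤ ℚ →ₗ[ℚ] Polynomial ℚ where
  toFun F := ∑ j ∈ Finset.range (d + 1),
    ((-1) ^ (d - j) * extrapolate (d - j) fun N => shellSum j (d - j) N F) •
      (Polynomial.X - 1 : Polynomial ℚ) ^ j
  map_add' F F' := by
    simp [extrapolate, mul_add, Finset.sum_add_distrib, add_smul]
  map_smul' c F := by
    simp only [extrapolate, map_smul, smul_eq_mul, Finset.smul_sum, RingHom.id_apply, smul_smul,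
      Finset.mul_sum]
    refine Finset.sum_congr rfl fun j _ => ?_
    congr 1
    exact Finset.sum_congr rfl fun k _ => by ring

theorem sinkFunctional_apply (d : ℕ) (F : MvPowerSeries ℤ ℚ) :
    sinkFunctional d F = ∑ j ∈ Finset.range (d + 1),
      ((-1) ^ (d - j) * extrapolate (d - j) fun N => shellSum j (d - j) N F) •
        (Polynomial.X - 1 : Polynomial ℚ) ^ j :=
  rfl

namespace Orientation

variable {V : Type u} {E : Type v} {G : SignedGraph V E} [Fintype V]

theorem isExtremal_univ_iff {P : G.Orientation} {v : V} :
    P.IsExtremal Finset.univ v true ↔ P.IsSink v := by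
  simp [IsExtremal, IsSink]

open Classical in
/-- The sets of sinks of `P`, encoded by their indicator functions. -/
noncomputable def sinkSets (P : G.Orientation) : Finset (V → SignType) :=
  Fintype.piFinset fun v => if P.IsSink v then {0, 1} else {0}

theorem mem_sinkSets {P : G.Orientation} {s : V → SignType} :
    s ∈ P.sinkSets ↔ ∀ v, s v ∈ P.shellSigns Finset.univ v ∧ s v ≠ -1 := by
  classical
  rw [sinkSets, Fintype.mem_piFinset]
  refine forall_congr' fun v => ?_
  rw [mem_shellSigns, isExtremal_univ_iff]
  split_ifs with h <;> rcases s v <;> simp [h]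

open Classical in
/-- The expansion of `t ^ sink(P)` in powers of `t - 1`. -/
theorem sum_sinkSets (P : G.Orientation) :
    ∑ s ∈ P.sinkSets, (Polynomial.X - 1 : Polynomial ℚ) ^ (Finset.univ.filter fun v => s v = 1).card
      = Polynomial.X ^ P.sinkCount := by
  have h1 : ∀ s : V → SignType,
      (Polynomial.X - 1 : Polynomial ℚ) ^ (Finset.univ.filter fun v => s v = 1).card =
        ∏ v, if s v = 1 then Polynomial.X - 1 else 1 := by
    intro s
    rw [← Finset.prod_filter, Finset.prod_const]
  have h2 : P.sinkCount = (Finset.univ.filter fun v => P.IsSink v).card := by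
    rw [sinkCount, ← Set.ncard_coe_finset]
    simp
  simp_rw [h1]
  rw [sinkSets, ← Finset.prod_univ_sum _ fun v x => if x = 1 then (Polynomial.X - 1 : Polynomial ℚ)
    else 1, h2, ← Finset.prod_const, Finset.prod_filter]
  refine Finset.prod_congr rfl fun v _ => ?_
  split_ifs <;> simp

theorem coeff_ySeries (P : G.Orientation) (m : ℤ →₀ ℕ) :
    MvPowerSeries.coeff m P.ySeries =
      Set.ncard {κ | (∀ e, P.Compatible κ e) ∧ ∑ v, Finsupp.single (κ v) 1 = m} := by
  simp only [← isProper_and_isPreservedBy_iff]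
  rfl

theorem shellSum_ySeries_of_ne (P : G.Orientation) {j r : ℕ} (h : Fintype.card V ≠ j + r) (N : ℕ) :
    shellSum j r N P.ySeries = 0 := by
  rw [shellSum, LinearMap.sum_apply]
  refine Finset.sum_eq_zero fun m hm => ?_
  rw [coeff_ySeries, Nat.cast_eq_zero]
  convert Set.ncard_empty (V → ℤ)
  refine Set.eq_empty_of_forall_notMem fun κ hκ => h ?_
  rw [← degree_sum_single κ, hκ.2, map_add, Finsupp.degree_single, add_comm,
    ← (Finset.mem_finsuppAntidiag'.1 hm).1]
  rfl

open Classical in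
theorem shellSum_ySeries (P : G.Orientation) {j r : ℕ} (h : Fintype.card V = j + r) {N : ℕ}
    (hN : N ≠ 0) :
    shellSum j r N P.ySeries =
      ∑ s ∈ P.sinkSets with (Finset.univ.filter fun v => s v = 1).card = j,
        P.orderCount (Finset.univ.filter fun v => s v = 0) N := by
  -- Both sides count the strict colorings with colors in `(-N, N]` that take the color `N` exactly
  -- `j` times: the left side by their monomials, the right side by the places of the color `N`.
  let Q : Finset (V → ℤ) := (P.strictColorings Finset.univ (N + 1)).filter fun κ =>
    (∀ v, κ v ≠ -N) ∧ (Finset.univ.filter fun v => κ v = N).card = j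
  have hshell1 : ∀ (κ : V → ℤ) v, shell N κ v = 1 ↔ κ v = N := by
    intro κ v
    rw [shell]
    split_ifs <;> simp_all
  have hshell2 : ∀ (κ : V → ℤ) v, shell N κ v = -1 ↔ κ v = -N := by
    intro κ v
    rw [shell]
    split_ifs with h1 h2 <;> simp_all
  have hQ : (Q.card : ℚ) = ∑ s ∈ P.sinkSets with (Finset.univ.filter fun v => s v = 1).card = j,
      P.orderCount (Finset.univ.filter fun v => s v = 0) N := by
    rw [Finset.card_eq_sum_card_fiberwise (f := shell N)
      (t := P.sinkSets.filter fun s => (Finset.univ.filter fun v => s v = 1).card = j),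
      Nat.cast_sum]
    · refine Finset.sum_congr rfl fun s hs => ?_
      obtain ⟨hs, hj⟩ := Finset.mem_filter.1 hs
      rw [mem_sinkSets] at hs
      rw [orderCount, if_neg hN, ← card_filter_shell_eq hN fun v => (hs v).1, Finset.filter_filter]
      congr 2
      refine Finset.filter_congr fun κ _ => ⟨fun h => h.2, fun h => ⟨⟨fun v => ?_, ?_⟩, h⟩⟩
      · rw [Ne, ← hshell2, h]
        exact (hs v).2
      · simpa only [← hshell1, h] using hj
    · intro κ hκ
      obtain ⟨hκ, hκ1, hκ2⟩ := Finset.mem_filter.1 hκ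
      refine Finset.mem_coe.2 (Finset.mem_filter.2 ⟨mem_sinkSets.2 fun v => ?_, ?_⟩)
      · exact ⟨shell_mem_shellSigns hN hκ v, fun h => hκ1 v ((hshell2 κ v).1 h)⟩
      · simpa only [hshell1] using hκ2
  rw [← hQ, shellSum, LinearMap.sum_apply, Finset.card_eq_sum_card_fiberwise
    (f := fun κ : V → ℤ => (∑ v, Finsupp.single (κ v) 1 : ℤ →₀ ℕ).erase (N : ℤ))
    (t := Finset.finsuppAntidiag (Finset.Ioo (-N : ℤ) N) r), Nat.cast_sum]
  · refine Finset.sum_congr rfl fun m hm => ?_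
    have hmN : ∀ a ∉ Finset.Ioo (-N : ℤ) N, m a = 0 := fun a ha => by
      by_contra h
      exact ha ((Finset.mem_finsuppAntidiag.1 hm).2 (Finsupp.mem_support_iff.2 h))
    rw [coeff_ySeries, Nat.cast_inj, ← Set.ncard_coe_finset]
    congr 1
    ext κ
    simp only [Set.mem_ofPred_eq, Finset.coe_filter, Q, Finset.mem_filter, mem_strictColorings]
    constructor
    · rintro ⟨hc, hκ⟩
      have hcount : ∀ a, (Finset.univ.filter fun v => κ v = a).card =
          (m + Finsupp.single (N : ℤ) j) a := fun a => by rw [← hκ, sum_single_apply]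
      have hpos : ∀ v, m (κ v) ≠ 0 ∨ κ v = N := by
        intro v
        have h1 := hcount (κ v)
        have h2 : (Finset.univ.filter fun w => κ w = κ v).card ≠ 0 :=
          Finset.card_ne_zero_of_mem (Finset.mem_filter.2 ⟨Finset.mem_univ v, rfl⟩)
        by_contra! h3
        rw [h1, Finsupp.add_apply, h3.1, Finsupp.single_eq_of_ne h3.2] at h2
        exact h2 rfl
      have hbd : ∀ v, -(N : ℤ) < κ v ∧ κ v ≤ N := by
        intro v
        rcases hpos v with h | h
        · have := Finset.mem_Ioo.1 (not_not.1 (mt (hmN (κ v)) h))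
          omega
        · omega
      refine ⟨⟨⟨fun v _ => ?_, by simp, fun e _ => hc e⟩, fun v => ?_, ?_⟩, ?_⟩
      · have := hbd v
        push_cast
        omega
      · exact (hbd v).1.ne'
      · rw [hcount, Finsupp.add_apply, hmN _ (by simp), Finsupp.single_eq_same, zero_add]
      · rw [hκ, Finsupp.erase_add, Finsupp.erase_single, add_zero,
          Finsupp.erase_of_notMem_support (by simp [hmN])]
    · rintro ⟨⟨⟨-, -, hc⟩, -, hj⟩, hκ⟩
      refine ⟨fun e => hc e (by simp), ?_⟩
      rw [← hκ, ← hj, ← sum_single_apply]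
      exact (Finsupp.erase_add_single _ _).symm
  · intro κ hκ
    obtain ⟨hκ, hκ1, hκ2⟩ := Finset.mem_filter.1 hκ
    have hbd := (mem_strictColorings.1 hκ).1
    refine Finset.mem_coe.2 (Finset.mem_finsuppAntidiag'.2 ⟨?_, fun a ha => ?_⟩)
    · have h1 := degree_sum_single κ
      rw [← Finsupp.erase_add_single (N : ℤ) (∑ v, Finsupp.single (κ v) 1 : ℤ →₀ ℕ), map_add,
        Finsupp.degree_single, sum_single_apply, hκ2, h] at h1
      exact Nat.add_right_cancel (h1.trans (add_comm j r))
    · rw [Finsupp.support_erase, Finset.mem_erase, Finsupp.mem_support_iff, sum_single_apply] at ha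
      obtain ⟨v, hv⟩ := Finset.card_ne_zero.1 ha.2
      obtain rfl := (Finset.mem_filter.1 hv).2
      have h1 := hbd v (Finset.mem_univ v)
      have h2 := hκ1 v
      have h3 := ha.1
      push_cast at h1
      rw [Finset.mem_Ioo]
      omega

theorem sinkFunctional_ySeries_of_ne (P : G.Orientation) {d : ℕ} (h : Fintype.card V ≠ d) :
    sinkFunctional d P.ySeries = 0 := by
  rw [sinkFunctional_apply]
  refine Finset.sum_eq_zero fun j hj => ?_
  have hj := Nat.lt_succ_iff.1 (Finset.mem_range.1 hj)
  have h' : Fintype.card V ≠ j + (d - j) := by omega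
  simp [shellSum_ySeries_of_ne P h', extrapolate]

theorem sinkFunctional_ySeries [Finite E] {P : G.Orientation} (hP : P.IsAcyclic) :
    sinkFunctional (Fintype.card V) P.ySeries = Polynomial.X ^ P.sinkCount := by
  classical
  have hcard : ∀ s ∈ P.sinkSets, (Finset.univ.filter fun v => s v = 0).card +
      (Finset.univ.filter fun v => s v = 1).card = Fintype.card V := by
    intro s hs
    rw [← Finset.card_univ,
      ← Finset.card_filter_add_card_filter_not (s := Finset.univ) fun v => s v = 0]
    congr 2
    refine Finset.filter_congr fun v _ => ?_
    have := (mem_sinkSets.1 hs v).2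
    generalize s v = x at *
    revert x
    decide
  rw [sinkFunctional_apply, ← sum_sinkSets, ← Finset.sum_fiberwise_of_maps_to
    (t := Finset.range (Fintype.card V + 1))
    (g := fun s : V → SignType => (Finset.univ.filter fun v => s v = 1).card)
    (fun s _ => Finset.mem_range_succ_iff.2 (Finset.card_le_univ _))]
  refine Finset.sum_congr rfl fun j hj => ?_
  obtain ⟨r, hr⟩ := Nat.exists_eq_add_of_le (Finset.mem_range_succ_iff.1 hj)
  let f : ℕ → ℚ := ∑ s ∈ P.sinkSets with (Finset.univ.filter fun v => s v = 1).card = j,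
    P.orderCount (Finset.univ.filter fun v => s v = 0)
  have hs : ∀ s ∈ P.sinkSets.filter fun s => (Finset.univ.filter fun v => s v = 1).card = j,
      (Finset.univ.filter fun v => s v = 0).card = r := by
    intro s hs
    obtain ⟨hs, h⟩ := Finset.mem_filter.1 hs
    have := hcard s hs
    omega
  have h1 : extrapolate r (fun N => shellSum j r N P.ySeries) = extrapolate r f := by
    refine Finset.sum_congr rfl fun k _ => ?_
    exact congrArg _
      ((shellSum_ySeries P hr k.succ_ne_zero).trans (Finset.sum_apply _ _ _).symm)
  have h3 : f 0 = ∑ s ∈ P.sinkSets with (Finset.univ.filter fun v => s v = 1).card = j,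
      P.orderCount (Finset.univ.filter fun v => s v = 0) 0 := Finset.sum_apply _ _ _
  have h2 : (fwdDiff 1)^[r + 1] f = 0 := by
    rw [fwdDiff_iter_finsetSum]
    refine Finset.sum_eq_zero fun s h => fwdDiff_iter_orderCount hP _ ?_
    rw [hs s h]
    exact Nat.lt_succ_self r
  rw [show Fintype.card V - j = r by omega, h1, extrapolate_eq h2, h3,
    Finset.mul_sum, Finset.sum_smul]
  refine Finset.sum_congr rfl fun s h => ?_
  rw [orderCount, if_pos rfl, hs s h, (Finset.mem_filter.1 h).2, ← mul_pow]
  simp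

end Orientation

/-! ### The linear map `φ` -/

/-- The functional `sinkFunctional d` vanishes at `Y_P` unless `P` has `d` vertices. -/
theorem finite_support_sinkFunctional {Y : MvPowerSeries ℤ ℚ}
    (hY : Y ∈ signedPosetSpan.{u, v}) : (Function.support fun d => sinkFunctional d Y).Finite := by
  induction hY using Submodule.span_induction with
  | mem Y h =>
    obtain ⟨V, E, _, _, G, P, hP, rfl⟩ := h
    refine (Set.finite_singleton (Fintype.card V)).subset fun d hd => ?_
    by_contra h
    exact hd (P.sinkFunctional_ySeries_of_ne fun h' => h h'.symm)
  | zero => simp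
  | add Y Y' _ _ h h' =>
    simp only [map_add]
    exact (h.union h').subset (Function.support_add _ _)
  | smul c Y _ h =>
    simp only [map_smul]
    exact h.subset (Function.support_const_smul_subset c _)

/-- The linear map `φ`: the sum of the functionals `sinkFunctional d` over all degrees `d`. -/
noncomputable def sinkCounting : signedPosetSpan.{u, v} →ₗ[ℚ] Polynomial ℚ where
  toFun Y := ∑ᶠ d, sinkFunctional d Y.1
  map_add' Y Y' := by
    simp only [Submodule.coe_add, map_add]
    exact finsum_add_distrib (finite_support_sinkFunctional Y.2)
      (finite_support_sinkFunctional Y'.2)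
  map_smul' c Y := by
    simp only [Submodule.coe_smul, map_smul, RingHom.id_apply]
    exact (smul_finsum c _).symm

theorem isSinkCounting_sinkCounting : IsSinkCounting sinkCounting.{u, v} := by
  intro V E _ _ G P hP
  refine (finsum_eq_single _ (Fintype.card V) fun d hd => ?_).trans (P.sinkFunctional_ySeries hP)
  exact P.sinkFunctional_ySeries_of_ne hd.symm

theorem isSinkCounting_unique {φ ψ : signedPosetSpan.{u, v} →ₗ[ℚ] Polynomial ℚ}
    (hφ : IsSinkCounting φ) (hψ : IsSinkCounting ψ) : φ = ψ := by
  ext1 ⟨Y, hY⟩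
  induction hY using Submodule.span_induction with
  | mem Y h =>
    obtain ⟨V, E, _, _, G, P, hP, rfl⟩ := h
    exact (hφ V E G P hP).trans (hψ V E G P hP).symm
  | zero => exact (map_zero φ).trans (map_zero ψ).symm
  | add Y Y' hY hY' h h' =>
    exact (map_add φ ⟨Y, hY⟩ ⟨Y', hY'⟩).trans
      ((congrArg₂ (· + ·) h h').trans (map_add ψ ⟨Y, hY⟩ ⟨Y', hY'⟩).symm)
  | smul c Y hY h =>
    exact (map_smul φ c ⟨Y, hY⟩).trans ((congrArg (c • ·) h).trans (map_smul ψ c ⟨Y, hY⟩).symm)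

end SignedGraph

theorem mainTheorem3 :
    (∃! φ : signedPosetSpan.{u, v} →ₗ[ℚ] Polynomial ℚ, IsSinkCounting φ) ∧
      ∀ φ : signedPosetSpan.{u, v} →ₗ[ℚ] Polynomial ℚ, IsSinkCounting φ →
        ∀ (V : Type u) (E : Type v) [Fintype V] [Finite E] (G : SignedGraph V E),
          G.chromaticB = ∑ P ∈ G.acyclicOrientations, P.ySeries ∧
            ∃ hG : G.chromaticB ∈ signedPosetSpan.{u, v},
              φ ⟨G.chromaticB, hG⟩ =
                ∑ k ∈ Finset.range (Fintype.card V + 1),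
                  Polynomial.C (G.acyc k : ℚ) * Polynomial.X ^ k := by
  refine ⟨⟨SignedGraph.sinkCounting, SignedGraph.isSinkCounting_sinkCounting, fun ψ hψ =>
    SignedGraph.isSinkCounting_unique hψ SignedGraph.isSinkCounting_sinkCounting⟩, ?_⟩
  intro φ hφ V E _ _ G
  have hmem : ∀ P ∈ G.acyclicOrientations, P.IsAcyclic := by
    intro P hP
    simp only [SignedGraph.acyclicOrientations, Finset.mem_filter] at hP
    exact hP.2
  have hsum := SignedGraph.chromaticB_eq_sum G
  have hG : G.chromaticB ∈ signedPosetSpan.{u, v} := hsum ▸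
    Submodule.sum_mem _ fun P hP => ySeries_mem_span P (hmem P hP)
  refine ⟨hsum, hG, ?_⟩
  have h1 : (⟨G.chromaticB, hG⟩ : signedPosetSpan.{u, v}) =
      ∑ P ∈ G.acyclicOrientations.attach,
        ⟨P.1.ySeries, ySeries_mem_span P.1 (hmem P.1 P.2)⟩ := by
    apply Subtype.ext
    rw [AddSubmonoidClass.coe_finsetSum]
    exact hsum.trans (Finset.sum_attach _ fun P : G.Orientation => P.ySeries).symm
  rw [h1, map_sum, Finset.sum_congr rfl fun P _ => hφ V E G P.1 (hmem P.1 P.2),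
    Finset.sum_attach _ fun P : G.Orientation => (Polynomial.X : Polynomial ℚ) ^ P.sinkCount,
    ← Finset.sum_fiberwise_of_maps_to (t := Finset.range (Fintype.card V + 1))
      (g := fun P : G.Orientation => P.sinkCount)]
  · refine Finset.sum_congr rfl fun k _ => ?_
    rw [Finset.sum_congr rfl fun P hP => congrArg _ (Finset.mem_filter.1 hP).2, Finset.sum_const,
      SignedGraph.acyc, nsmul_eq_mul, map_natCast]
  · intro P _
    rw [Finset.mem_range_succ_iff, ← Nat.card_eq_fintype_card]
    exact Set.ncard_le_card _
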